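/- Let $k$ be an algebraically closed field of characteristic $0$ with the trivial absolute value ($|0|=0$, and $|c|=1$ for $c\neq 0$), let $V$ be an $n$-dimensional $k$-vector space, and let $G=\mathrm{GL}(V)$ with coordinate ring $k[G]$. Let $G^{\mathrm{an}}$ be the Berkovich analytification of $G$, i.e. the set of multiplicative non-Archimedean seminorms on $k[G]$ extending $|\cdot|$, with the coarsest topology making all evaluations $\|\cdot\|\mapsto\|f\|$, $f\in k[G]$, continuous. For a torus $T\le G$ with character lattice $M$ and $\lambda\in T^{\mathrm{trop}}=\mathrm{Hom}(M,\mathbb R)$, let $t_\lambda\in T^{\mathrm{an}}\subseteq G^{\mathrm{an}}$ be the point $\|\sum_m c_m\chi^m\|_{t_\lambda}=\max_m|c_m|e^{-\lambda(m)}$, and let $g_0\in G^{\mathrm{an}}$ be the trivial norm on $k[G]$. For $p,q\in G^{\mathrm{an}}$ let $p*q$ be their Berkovich product, $\|f\|_{p*q}=\inf\{\max_i\|a_i\|_p\|b_i\|_q : \Delta f=\sum_i a_i\otimes b_i\}$, where $\Delta$ is the comultiplication of $k[G]$. The assignment $t_\lambda\mapsto t_\lambda*g_0$ induces a map $\Theta\colon\varinjlim_{T\le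 G}T^{\mathrm{trop}}\to G^{\mathrm{an}}$ from the set-theoretic colimit over all tori of $G$, ordered by inclusion. Let $\mathrm{GL}(V)^{\mathrm{build}}_{\mathrm{Berk}}$ be the image of $\Theta$ with the subspace topology; thus points of the colimit with the same image under $\Theta$ are identified. The image of $t_\lambda$ in it is again denoted $t_\lambda$. Let $\mathcal N(V)$ be the Goldman–Iwahori space: the set of maps $\|\cdot\|\colon V^*\to\mathbb R_{\ge 0}$ with $\|u\|=0$ if and only if $u=0$, $\|cu\|=|c|\,\|u\|$ and $\|u+w\|\le\max\{\|u\|,\|w\|\}$ for all $c\in k$ and $u,w\in V^*$, with the coarsest topology making all evaluations $\|\cdot\|\mapsto\|u\|$, $u\in V^*$, continuous. For a basis $e=(e_1,\dots,e_n)$ of $V^*$ let $T_e\le G$ be the maximal torus of all $t$ such that each $e_i\circ t$ is a multiple $\varepsilon_i(t)e_i$ of $e_i$; identify $\lambda\in T_e^{\mathrm{trop}}$ with $(\lambda_1,\dots,\lambda_n)\in\mathbb R^n$, $\lambda_i=\lambda(\varepsilon_i)$, and put $\|\sum_i a_ie_i\|_{e,\lambda}=\max_i|a_i|e^{-\lambda_i}$.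 Then there is exactly one map $\alpha\colon\mathrm{GL}(V)^{\mathrm{build}}_{\mathrm{Berk}}\to\mathcal N(V)$ with $\alpha(t_\lambda)=\|\cdot\|_{e,\lambda}$ for every basis $e$ of $V^*$ and every $\lambda\in T_e^{\mathrm{trop}}$, and this map $\alpha$ is continuous and bijective. -/

import Mathlib

noncomputable section

namespace GLBuild

universe u v

/-! ### The algebraic group `GL(V)` and its subtori -/

/-- The group of `k`-points of `GL(V)`. -/
abbrev GLV (k : Type u) (V : Type v) [Field k] [AddCommGroup V] [Module k V] : Type v := V ≃ₗ[k] V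

/-- The coordinate ring `k[GL(V)]`, as the ring of regular functions on the `k`-points (`k` will be
algebraically closed): it is generated by the matrix coefficients and the inverse of the
determinant. -/
def CoordRing (k : Type u) (V : Type v) [Field k] [AddCommGroup V] [Module k V] :
    Subalgebra k (GLV k V → k) :=
  Algebra.adjoin k
    ({f | ∃ (l : Module.Dual k V) (v : V), f = fun g => l (g v)} ∪
      {fun g => (((LinearEquiv.det g)⁻¹ : kˣ) : k)})

/-- The coordinate ring of `𝔾ₘ ^ r`: Laurent polynomial functions on its `k`-points. -/
def Laurent (k : Type u) [Field k] (r : ℕ) : Subalgebra k ((Fin r → kˣ) → k) :=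
  Algebra.adjoin k
    (Set.range (fun (i : Fin r) (s : Fin r → kˣ) => (s i : k)) ∪
      Set.range (fun (i : Fin r) (s : Fin r → kˣ) => (((s i)⁻¹ : kˣ) : k)))

variable {k : Type u} {V : Type v} [Field k] [AddCommGroup V] [Module k V]

/-- A subgroup of `GL(V)` is a torus if it is the image of a closed immersion of algebraic groups
`φ : 𝔾ₘ ^ r → GL(V)`, that is, of a homomorphism such that `f ↦ f ∘ φ` maps the coordinate
ring of `GL(V)` onto the coordinate ring of `𝔾ₘ ^ r`. -/
def IsTorus (T : Subgroup (GLV k V)) : Prop :=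
  ∃ (r : ℕ) (φ : (Fin r → kˣ) ≃* T), ∀ h : (Fin r → kˣ) → k,
    h ∈ Laurent k r ↔ ∃ f ∈ CoordRing k V, ∀ s, h s = f (φ s)

/-- The tori in `GL(V)`. -/
abbrev Torus (k : Type u) (V : Type v) [Field k] [AddCommGroup V] [Module k V] : Type v :=
  {T : Subgroup (GLV k V) // IsTorus T}

/-- Regular functions on a closed subgroup: restrictions of regular functions on `GL(V)`. -/
def IsRegular (T : Subgroup (GLV k V)) (h : T → k) : Prop :=
  ∃ f ∈ CoordRing k V, ∀ t : T, h t = f t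

/-- The character group of `T`: homomorphisms of algebraic groups `T → 𝔾ₘ`. -/
def Characters (T : Subgroup (GLV k V)) : Subgroup (T →* kˣ) where
  carrier := {χ | IsRegular T (fun t => (χ t : k)) ∧ IsRegular T (fun t => (((χ t)⁻¹ : kˣ) : k))}
  one_mem' := ⟨⟨1, one_mem _, fun t => by simp⟩, ⟨1, one_mem _, fun t => by simp⟩⟩
  mul_mem' := by
    rintro χ ψ ⟨⟨f, hf, hf'⟩, ⟨f₁, hf₁, hf₁'⟩⟩ ⟨⟨g, hg, hg'⟩, ⟨g₁, hg₁, hg₁'⟩⟩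
    refine ⟨⟨f * g, mul_mem hf hg, fun t => ?_⟩, ⟨f₁ * g₁, mul_mem hf₁ hg₁, fun t => ?_⟩⟩
    · simp [hf', hg']
    · simp only [MonoidHom.mul_apply, mul_inv, Units.val_mul, Pi.mul_apply]
      exact congrArg₂ (· * ·) (hf₁' t) (hg₁' t)
  inv_mem' := by
    rintro χ ⟨h, h'⟩
    exact ⟨h', by simpa using h⟩

/-- The tropicalization `T^trop = N ⊗ ℝ = Hom(M, ℝ)`, where `M` is the character lattice. -/
abbrev Trop (T : Subgroup (GLV k V)) : Type _ := Additive (Characters T) →+ ℝ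

/-- Restriction of characters along `S ≤ T`. -/
def resChar {S T : Subgroup (GLV k V)} (h : S ≤ T) : Characters T →* Characters S where
  toFun χ := ⟨χ.1.comp (Subgroup.inclusion h), by
    obtain ⟨⟨f, hf, hf'⟩, ⟨g, hg, hg'⟩⟩ := χ.2
    exact ⟨⟨f, hf, fun t => hf' (Subgroup.inclusion h t)⟩,
      ⟨g, hg, fun t => hg' (Subgroup.inclusion h t)⟩⟩⟩
  map_one' := rfl
  map_mul' _ _ := rfl

/-- The linear map `S^trop → T^trop` induced by an inclusion of tori `S ≤ T`. -/
def tropMap {S T : Subgroup (GLV k V)} (h : S ≤ T) (a : Trop S) : Trop T :=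
  a.comp (MonoidHom.toAdditive (resChar h))

/-- The building `GL(V)^build` before Berkovich's realization: the colimit of the sets `T^trop` over
all tori `T` of `GL(V)`, ordered by inclusion. -/
def Colim (k : Type u) (V : Type v) [Field k] [AddCommGroup V] [Module k V] : Type _ :=
  Quot (fun x y : (Σ T : Torus k V, Trop T.1) =>
    ∃ h : x.1.1 ≤ y.1.1, tropMap h x.2 = y.2)

/-! ### The trivial absolute value, seminorms on the coordinate ring -/

open Classical in
/-- The trivial absolute value. -/
def trivAbs {A : Type*} [Zero A] (a : A) : ℝ := if a = 0 then 0 else 1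

lemma trivAbs_zero {A : Type*} [Zero A] : trivAbs (0 : A) = 0 := by simp [trivAbs]

lemma trivAbs_of_ne {A : Type*} [Zero A] {a : A} (h : a ≠ 0) : trivAbs a = 1 := by
  simp [trivAbs, h]

lemma trivAbs_nonneg {A : Type*} [Zero A] (a : A) : 0 ≤ trivAbs a := by
  unfold trivAbs; split_ifs <;> norm_num

/-- `c` is the expansion in characters of the restriction of `f` to `T`. -/
def IsExpansion (T : Subgroup (GLV k V)) (f : CoordRing k V) (c : Characters T →₀ k) : Prop :=
  ∀ t : T, f.1 t = c.sum (fun m a => a * (m.1 t : k))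

lemma characters_linearIndependent (T : Subgroup (GLV k V)) :
    LinearIndependent k (fun (m : Characters T) (t : T) => ((m.1 t : kˣ) : k)) := by
  have h := linearIndependent_monoidHom T k
  have hinj : Function.Injective
      (fun m : Characters T => ((Units.coeHom k).comp m.1 : T →* k)) := by
    intro m n hmn
    apply Subtype.ext
    ext t
    exact DFunLike.congr_fun hmn t
  exact h.comp _ hinj

lemma expansion_unique {T : Subgroup (GLV k V)} {c d : Characters T →₀ k}
    (h : ∀ t : T, c.sum (fun m a => a * (m.1 t : k)) = d.sum (fun m a => a * (m.1 t : k))) :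
    c = d := by
  refine characters_linearIndependent T ?_
  funext t
  simpa [Finsupp.linearCombination_apply, Finsupp.sum, Finset.sum_apply] using h t

lemma exists_expansion {T : Subgroup (GLV k V)} (hT : IsTorus T) (f : CoordRing k V) :
    ∃ c, IsExpansion T f c := by
  obtain ⟨r, φ, hφ⟩ := hT
  -- monomials are characters
  have key : ∀ h ∈ Laurent k r, ∃ c : Characters T →₀ k,
      ∀ s, h s = c.sum (fun m a => a * (m.1 (φ s) : k)) := by
    have hchar : ∀ χ : (Fin r → kˣ) →* kˣ, (fun s => (χ s : k)) ∈ Laurent k r →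
        (fun s => (((χ s)⁻¹ : kˣ) : k)) ∈ Laurent k r →
        ∃ c : Characters T →₀ k, ∀ s, (χ s : k) = c.sum (fun m a => a * (m.1 (φ s) : k)) := by
      intro χ h1 h2
      have hr : ∀ h : (Fin r → kˣ) → k, h ∈ Laurent k r →
          IsRegular T (fun t => h (φ.symm t)) := by
        intro h hh
        obtain ⟨f, hf, hf'⟩ := (hφ h).1 hh
        exact ⟨f, hf, fun t => by simpa using hf' (φ.symm t)⟩
      refine ⟨Finsupp.single ⟨χ.comp φ.symm.toMonoidHom, hr _ h1, hr _ h2⟩ 1, fun s => ?_⟩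
      simp
    intro h hh
    refine Algebra.adjoin_induction (p := fun h _ => ∃ c : Characters T →₀ k,
      ∀ s, h s = c.sum (fun m a => a * (m.1 (φ s) : k))) ?_ ?_ ?_ ?_ hh
    · rintro _ (⟨i, rfl⟩ | ⟨i, rfl⟩)
      · refine hchar (Pi.evalMonoidHom _ i) ?_ ?_
        · exact Algebra.subset_adjoin (Or.inl ⟨i, rfl⟩)
        · exact Algebra.subset_adjoin (Or.inr ⟨i, rfl⟩)
      · refine hchar ((Pi.evalMonoidHom (fun _ => kˣ) i)⁻¹) ?_ ?_
        · exact Algebra.subset_adjoin (Or.inr ⟨i, rfl⟩)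
        · refine Algebra.subset_adjoin (Or.inl ⟨i, ?_⟩)
          funext s
          simp
    · intro a
      exact ⟨Finsupp.single 1 a, fun s => by simp⟩
    · rintro x y _ _ ⟨c, hc⟩ ⟨d, hd⟩
      refine ⟨c + d, fun s => ?_⟩
      rw [Finsupp.sum_add_index' (by simp) (by intros; ring), Pi.add_apply, hc, hd]
    · rintro x y _ _ ⟨c, hc⟩ ⟨d, hd⟩
      refine ⟨c.sum fun m a => d.sum fun n b => Finsupp.single (m * n) (a * b), fun s => ?_⟩
      rw [Pi.mul_apply, hc, hd, Finsupp.sum_sum_index (by simp) (by intros; ring),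
        Finsupp.sum_mul]
      refine Finsupp.sum_congr fun m _ => ?_
      rw [Finsupp.sum_sum_index (by simp) (by intros; ring), Finsupp.mul_sum]
      refine Finsupp.sum_congr fun n _ => ?_
      rw [Finsupp.sum_single_index (by simp)]
      simp only [Subgroup.coe_mul, MonoidHom.mul_apply, Units.val_mul]
      ring
  obtain ⟨c, hc⟩ := key (fun s => f.1 (φ s)) ((hφ _).2 ⟨f.1, f.2, fun _ => rfl⟩)
  exact ⟨c, fun t => by simpa using hc (φ.symm t)⟩

/-- The coefficients `c_m` of `f|_T = ∑ c_m χ^m`. -/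
def coeffs (T : Torus k V) (f : CoordRing k V) : Characters T.1 →₀ k :=
  Classical.choose (exists_expansion T.2 f)

/-- The point `t_a` of `T^an ⊆ GL(V)^an` attached to `a ∈ T^trop`:
`‖∑ c_m χ^m‖ = max |c_m| exp (- a(m))`. -/
def shilov (T : Torus k V) (a : Trop T.1) (f : CoordRing k V) : ℝ :=
  ⨆ m : Characters T.1, trivAbs (coeffs T f m) * Real.exp (-(a (Additive.ofMul m)))

/-- The point `g₀` of `GL(V)^an`: the trivial norm on the coordinate ring. -/
def trivPoint (f : CoordRing k V) : ℝ := trivAbs f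

/-- Berkovich's product `p ∗ q`: the pull back along the comultiplication `f(gh)` of the tensor
product norm `‖F‖ = inf {max ‖a_i‖ ‖b_i‖ | F = ∑ a_i ⊗ b_i}`. -/
def star (p q : CoordRing k V → ℝ) (f : CoordRing k V) : ℝ :=
  sInf {r | ∃ (n : ℕ) (a b : Fin n → CoordRing k V),
    (∀ g h : GLV k V, f.1 (g * h) = ∑ i, (a i).1 g * (b i).1 h) ∧ r = ⨆ i, p (a i) * q (b i)}

/-! ### The map to the analytification is well defined on the colimit -/

lemma coeffs_spec (T : Torus k V) (f : CoordRing k V) : IsExpansion T.1 f (coeffs T f) :=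
  Classical.choose_spec (exists_expansion T.2 f)

lemma coeffs_eq {T : Torus k V} {f : CoordRing k V} {c : Characters T.1 →₀ k}
    (h : IsExpansion T.1 f c) : coeffs T f = c :=
  expansion_unique fun t => by rw [← coeffs_spec T f t, h t]

lemma coeffs_sum {ι : Type*} [Fintype ι] (T : Torus k V) (f : CoordRing k V) (z : ι → k)
    (a : ι → CoordRing k V) (h : ∀ t : T.1, f.1 t = ∑ i, (a i).1 t * z i) :
    coeffs T f = ∑ i, z i • coeffs T (a i) := by
  refine coeffs_eq fun t => ?_
  rw [h t, ← Finsupp.sum_finsetSum_index (by simp) (by intros; ring)]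
  refine Finset.sum_congr rfl fun i _ => ?_
  rw [coeffs_spec T (a i) t, Finsupp.sum_smul_index (by simp), Finsupp.sum_mul]
  refine Finsupp.sum_congr fun m _ => ?_
  ring

lemma exists_comul_aux [FiniteDimensional k V] (f : GLV k V → k) (hf : f ∈ CoordRing k V) :
    ∃ (ι : Type) (_ : Fintype ι) (a b : ι → CoordRing k V),
      ∀ g h : GLV k V, f (g * h) = ∑ i, (a i).1 g * (b i).1 h := by
  refine Algebra.adjoin_induction (p := fun f _ => ∃ (ι : Type) (_ : Fintype ι)
    (a b : ι → CoordRing k V), ∀ g h : GLV k V, f (g * h) = ∑ i, (a i).1 g * (b i).1 h)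
    ?_ ?_ ?_ ?_ hf
  · rintro _ (⟨l, v, rfl⟩ | rfl)
    · let e := Module.finBasis k V
      refine ⟨Fin (Module.finrank k V), inferInstance,
        fun i => ⟨fun g => l (g (e i)), Algebra.subset_adjoin (Or.inl ⟨l, e i, rfl⟩)⟩,
        fun i => ⟨fun g => e.coord i (g v), Algebra.subset_adjoin (Or.inl ⟨_, v, rfl⟩)⟩, ?_⟩
      intro g h
      have := congrArg (fun w => l (g w)) (e.sum_repr (h v))
      simp only [map_sum, map_smul, smul_eq_mul] at this
      simp only [LinearEquiv.mul_apply, Module.Basis.coord_apply]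
      rw [← this]
      exact Finset.sum_congr rfl fun i _ => mul_comm _ _
    · refine ⟨Unit, inferInstance, fun _ => ⟨_, Algebra.subset_adjoin (Or.inr rfl)⟩,
        fun _ => ⟨_, Algebra.subset_adjoin (Or.inr rfl)⟩, ?_⟩
      intro g h
      simp [mul_comm]
  · intro c
    refine ⟨Unit, inferInstance, fun _ => algebraMap k _ c, fun _ => 1, ?_⟩
    intro g h
    simp
  · rintro x y _ _ ⟨ι, _, a, b, h⟩ ⟨κ, _, a', b', h'⟩
    refine ⟨ι ⊕ κ, inferInstance, Sum.elim a a', Sum.elim b b', ?_⟩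
    intro g g'
    simp [h, h']
  · rintro x y _ _ ⟨ι, _, a, b, h⟩ ⟨κ, _, a', b', h'⟩
    refine ⟨ι × κ, inferInstance, fun i => a i.1 * a' i.2, fun i => b i.1 * b' i.2, ?_⟩
    intro g g'
    simp only [Pi.mul_apply, h, h', Finset.sum_mul_sum, Fintype.sum_prod_type]
    refine Finset.sum_congr rfl fun i _ => Finset.sum_congr rfl fun j _ => ?_
    simp
    ring

lemma exists_independent {W : Type*} [AddCommGroup W] [Module k W] {ι : Type*} [Finite ι]
    (b : ι → W) : ∃ (n : ℕ) (b' : Fin n → W) (z : ι → Fin n → k), LinearIndependent k b' ∧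
      ∀ i, b i = ∑ j, z i j • b' j := by
  let S := Submodule.span k (Set.range b)
  have : FiniteDimensional k S := FiniteDimensional.span_of_finite k (Set.finite_range b)
  let β := Module.finBasis k S
  have hb : ∀ i, b i ∈ S := fun i => Submodule.subset_span ⟨i, rfl⟩
  refine ⟨Module.finrank k S, fun j => (β j : W), fun i => β.repr ⟨b i, hb i⟩,
    β.linearIndependent.map' S.subtype (Submodule.ker_subtype S), fun i => ?_⟩
  have h1 := congrArg S.subtype (β.sum_repr ⟨b i, hb i⟩)
  rw [map_sum] at h1
  exact h1.symm

lemma coe_sum_apply {ι : Type*} (t : Finset ι) (a : ι → CoordRing k V) (g : GLV k V) :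
    (∑ i ∈ t, a i).1 g = ∑ i ∈ t, (a i).1 g := by
  rw [show (∑ i ∈ t, a i).1 = ∑ i ∈ t, (a i).1 from map_sum (CoordRing k V).val a t,
    Finset.sum_apply]

lemma exists_comul [FiniteDimensional k V] (f : CoordRing k V) :
    ∃ (n : ℕ) (a b : Fin n → CoordRing k V), LinearIndependent k b ∧
      ∀ g h : GLV k V, f.1 (g * h) = ∑ i, (a i).1 g * (b i).1 h := by
  obtain ⟨ι, _, a, b, h⟩ := exists_comul_aux f.1 f.2
  obtain ⟨n, b', z, hb', hz⟩ := exists_independent (k := k) b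
  refine ⟨n, fun j => ∑ i, z i j • a i, b', hb', ?_⟩
  intro g g'
  have hb : ∀ i, (b i).1 g' = ∑ j, z i j * (b' j).1 g' := by
    intro i
    rw [hz i, coe_sum_apply]
    rfl
  simp only [h, hb, coe_sum_apply, Finset.mul_sum, Finset.sum_mul]
  rw [Finset.sum_comm]
  refine Finset.sum_congr rfl fun j _ => Finset.sum_congr rfl fun i _ => ?_
  rw [show (z i j • a i).1 g = z i j * (a i).1 g from rfl]
  ring

lemma exists_translate [FiniteDimensional k V] (f : CoordRing k V) (x : GLV k V) :
    (fun g => f.1 (g * x)) ∈ CoordRing k V := by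
  obtain ⟨n, a, b, -, h⟩ := exists_comul f
  have : (fun g => f.1 (g * x)) = ∑ i, ((b i).1 x) • (a i).1 := by
    funext g
    simp [h, mul_comm]
  rw [this]
  exact sum_mem fun i _ => Subalgebra.smul_mem _ (a i).2 _

/-- Right translate of a regular function. -/
def translate [FiniteDimensional k V] (f : CoordRing k V) (x : GLV k V) : CoordRing k V :=
  ⟨fun g => f.1 (g * x), exists_translate f x⟩

/-- The weights of `T` that occur in `f` under left translation. -/
def weights [FiniteDimensional k V] (T : Torus k V) (f : CoordRing k V) : Set (Characters T.1) :=
  {m | ∃ x, coeffs T (translate f x) m ≠ 0}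

lemma shilov_bdd (T : Torus k V) (a : Trop T.1) (f : CoordRing k V) :
    BddAbove (Set.range fun m : Characters T.1 =>
      trivAbs (coeffs T f m) * Real.exp (-(a (Additive.ofMul m)))) := by
  have : (Set.range fun m : Characters T.1 =>
      trivAbs (coeffs T f m) * Real.exp (-(a (Additive.ofMul m)))) ⊆
      insert 0 ((fun m => trivAbs (coeffs T f m) * Real.exp (-(a (Additive.ofMul m)))) ''
        ((coeffs T f).support : Set (Characters T.1))) := by
    rintro _ ⟨m, rfl⟩
    by_cases hm : coeffs T f m = 0
    · left; simp [hm, trivAbs_zero]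
    · right; exact ⟨m, by simpa using hm, rfl⟩
  exact ((((coeffs T f).support.finite_toSet).image _).insert 0).bddAbove.mono this

/-- The map `(T, a) ↦ t_a ∗ g₀`. -/
def thetaAux (x : Σ T : Torus k V, Trop T.1) : CoordRing k V → ℝ :=
  star (shilov x.1 x.2) trivPoint

lemma thetaAux_eq [FiniteDimensional k V] (T : Torus k V) (a : Trop T.1) (f : CoordRing k V) :
    thetaAux ⟨T, a⟩ f =
      sSup ((fun m : Characters T.1 => Real.exp (-(a (Additive.ofMul m)))) '' weights T f) := by
  have hco : ∀ (n : ℕ) (c b : Fin n → CoordRing k V),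
      (∀ g h : GLV k V, f.1 (g * h) = ∑ i, (c i).1 g * (b i).1 h) → ∀ x m,
      coeffs T (translate f x) m = ∑ i, (b i).1 x * coeffs T (c i) m := by
    intro n c b h x m
    rw [coeffs_sum T (translate f x) (fun i => (b i).1 x) c (fun t => h t x)]
    simp
  have hpos : ∀ c : CoordRing k V, 0 ≤ shilov T a c := fun c =>
    Real.iSup_nonneg fun m => mul_nonneg (trivAbs_nonneg _) (Real.exp_pos _).le
  have hpos' : ∀ c : CoordRing k V, 0 ≤ trivPoint c := fun c => trivAbs_nonneg _
  -- every representation bounds the right hand side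
  have hlow : ∀ (n : ℕ) (c b : Fin n → CoordRing k V),
      (∀ g h : GLV k V, f.1 (g * h) = ∑ i, (c i).1 g * (b i).1 h) →
      ∀ m ∈ weights T f, Real.exp (-(a (Additive.ofMul m))) ≤
        ⨆ i, shilov T a (c i) * trivPoint (b i) := by
    rintro n c b h m ⟨x, hx⟩
    rw [hco n c b h] at hx
    obtain ⟨i, -, hi⟩ := Finset.exists_ne_zero_of_sum_ne_zero hx
    have h1 : (b i) ≠ 0 := by
      rintro h0
      simp [h0] at hi
    have h2 : coeffs T (c i) m ≠ 0 := right_ne_zero_of_mul hi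
    refine le_trans ?_ (le_ciSup (Set.finite_range _).bddAbove i)
    rw [trivPoint, trivAbs_of_ne h1, mul_one]
    refine le_trans ?_ (le_ciSup (shilov_bdd T a (c i)) m)
    rw [trivAbs_of_ne h2, one_mul]
  apply le_antisymm
  · obtain ⟨n, c, b, hb, h⟩ := exists_comul f
    refine le_trans (csInf_le ⟨0, ?_⟩ ⟨n, c, b, h, rfl⟩) ?_
    · rintro _ ⟨n, c, b, -, rfl⟩
      exact Real.iSup_nonneg fun i => mul_nonneg (hpos _) (hpos' _)
    · have hbdd : BddAbove ((fun m : Characters T.1 => Real.exp (-(a (Additive.ofMul m)))) ''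
          weights T f) := by
        refine ⟨⨆ i, shilov T a (c i) * trivPoint (b i), ?_⟩
        rintro _ ⟨m, hm, rfl⟩
        exact hlow n c b h m hm
      have hnn : 0 ≤ sSup ((fun m : Characters T.1 => Real.exp (-(a (Additive.ofMul m)))) ''
          weights T f) := by
        apply Real.sSup_nonneg
        rintro _ ⟨m, -, rfl⟩
        exact (Real.exp_pos _).le
      refine Real.iSup_le (fun i => ?_) hnn
      have hbi : b i ≠ 0 := hb.ne_zero i
      change shilov T a (c i) * trivPoint (b i) ≤ _
      rw [trivPoint, trivAbs_of_ne hbi, mul_one]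
      refine Real.iSup_le (fun m => ?_) hnn
      by_cases hm : coeffs T (c i) m = 0
      · rw [hm, trivAbs_zero, zero_mul]; exact hnn
      · rw [trivAbs_of_ne hm, one_mul]
        refine le_csSup hbdd ⟨m, ?_, rfl⟩
        by_contra hw
        have hw' : ∀ x, coeffs T (translate f x) m = 0 := by
          intro x
          by_contra hx
          exact hw ⟨x, hx⟩
        refine hm (Fintype.linearIndependent_iff.1 hb (fun i => coeffs T (c i) m) ?_ i)
        apply Subtype.ext
        funext x
        have h0 := hw' x
        rw [hco n c b h] at h0
        rw [coe_sum_apply]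
        refine Eq.trans (Finset.sum_congr rfl fun j _ => ?_) h0
        exact mul_comm _ _
  · refine le_csInf ?_ ?_
    · obtain ⟨n, c, b, -, h⟩ := exists_comul f
      exact ⟨_, n, c, b, h, rfl⟩
    · rintro _ ⟨n, c, b, h, rfl⟩
      refine Real.sSup_le ?_ (Real.iSup_nonneg fun i => mul_nonneg (hpos _) (hpos' _))
      rintro _ ⟨m, hm, rfl⟩
      exact hlow n c b h m hm

lemma coeffs_translate [FiniteDimensional k V] {S T : Torus k V} (h : S.1 ≤ T.1)
    (f : CoordRing k V) (s : T.1) (x : GLV k V) :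
    coeffs S (translate f (s * x)) =
      (coeffs T (translate f x)).sum
        (fun m c => Finsupp.single (resChar h m) (c * (m.1 s : k))) := by
  refine coeffs_eq fun t => ?_
  rw [Finsupp.sum_sum_index (by simp) (by intros; ring)]
  have h1 := coeffs_spec T (translate f x) (Subgroup.inclusion h t * s)
  have h2 : (translate f (s * x)).1 t =
      (translate f x).1 ((Subgroup.inclusion h t * s : T.1) : GLV k V) := by
    simp [translate, mul_assoc]
  rw [h2, h1]
  refine Finsupp.sum_congr fun m _ => ?_
  rw [Finsupp.sum_single_index (by simp), map_mul, Units.val_mul]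
  simp only [resChar, MonoidHom.coe_mk, OneHom.coe_mk, MonoidHom.comp_apply]
  ring

lemma weights_eq [FiniteDimensional k V] {S T : Torus k V} (h : S.1 ≤ T.1) (f : CoordRing k V) :
    weights S f = resChar h '' weights T f := by
  classical
  ext n
  constructor
  · rintro ⟨x, hx⟩
    have h1 := coeffs_translate h f 1 x
    simp only [Subgroup.coe_one, one_mul] at h1
    rw [h1, Finsupp.sum, Finsupp.finsetSum_apply] at hx
    obtain ⟨m, hm, hm'⟩ := Finset.exists_ne_zero_of_sum_ne_zero hx
    refine ⟨m, ⟨x, by simpa using hm⟩, ?_⟩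
    by_contra hne
    exact hm' (Finsupp.single_eq_of_ne (Ne.symm hne))
  · rintro ⟨m, ⟨x, hx⟩, rfl⟩
    by_contra hw
    have hw' : ∀ y, coeffs S (translate f y) (resChar h m) = 0 := by
      intro y
      by_contra hy
      exact hw ⟨y, hy⟩
    have hz : (coeffs T (translate f x)).filter (fun m' => resChar h m' = resChar h m) = 0 := by
      refine expansion_unique fun s => ?_
      have h1 := hw' (s * x)
      rw [coeffs_translate h f s x, Finsupp.sum, Finsupp.finsetSum_apply] at h1
      rw [Finsupp.sum_zero_index, ← h1, Finsupp.sum, Finsupp.support_filter, Finset.sum_filter]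
      refine Finset.sum_congr rfl fun m' _ => ?_
      by_cases hm' : resChar h m' = resChar h m
      · simp [hm']
      · simp [hm']
    apply hx
    have := DFunLike.congr_fun hz m
    simpa using this

/-- The map `Θ : GL(V)^build → GL(V)^an ⊆ ℝ ^ k[GL(V)]`, `t_a ↦ t_a ∗ g₀`. -/
def theta [FiniteDimensional k V] : Colim k V → (CoordRing k V → ℝ) :=
  Quot.lift thetaAux (by
    rintro ⟨S, a⟩ ⟨T, b⟩ ⟨h, hb⟩
    dsimp only at h hb
    subst hb
    funext f
    rw [thetaAux_eq, thetaAux_eq, weights_eq h, Set.image_image]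
    rfl)

/-- `GL(V)^build_Berk`: the image of `Θ` in `GL(V)^an`, with the topology induced by `GL(V)^an`.
The topology of `GL(V)^an` is the coarsest one for which all evaluations `‖·‖ ↦ ‖f‖` with
`f ∈ k[GL(V)]` are continuous, that is, the one induced by the product topology. -/
abbrev BerkBuilding (k : Type u) (V : Type v) [Field k] [AddCommGroup V] [Module k V]
    [FiniteDimensional k V] : Type _ :=
  Set.range (theta (k := k) (V := V))

/-! ### Non-Archimedean norms and the Goldman-Iwahori space -/

/-- Non-Archimedean norms on a vector space over the trivially valued field `k`. -/
@[ext]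
structure NANorm (k : Type u) (W : Type v) [Field k] [AddCommGroup W] [Module k W] where
  toFun : W → ℝ
  nonneg' : ∀ w, 0 ≤ toFun w
  eq_zero_iff' : ∀ w, toFun w = 0 ↔ w = 0
  smul' : ∀ (c : k) (w : W), toFun (c • w) = trivAbs c * toFun w
  add_le' : ∀ w w', toFun (w + w') ≤ max (toFun w) (toFun w')

/-- The Goldman-Iwahori space: norms on the dual space of `V`. -/
def GoldmanIwahori (k : Type u) (V : Type v) [Field k] [AddCommGroup V] [Module k V] : Type _ :=
  NANorm k (Module.Dual k V)

/-- The coarsest topology for which all evaluations are continuous. -/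
instance : TopologicalSpace (GoldmanIwahori k V) :=
  ⨅ u : Module.Dual k V,
    TopologicalSpace.induced (fun N : GoldmanIwahori k V => N.toFun u) inferInstance

lemma trivAbs_mul (c d : k) : trivAbs (c * d) = trivAbs c * trivAbs d := by
  unfold trivAbs
  by_cases hc : c = 0 <;> by_cases hd : d = 0 <;> simp [hc, hd]

lemma trivAbs_add_le (c d : k) : trivAbs (c + d) ≤ max (trivAbs c) (trivAbs d) := by
  unfold trivAbs
  by_cases hc : c = 0 <;> by_cases hd : d = 0 <;> simp [hc, hd]
  split_ifs <;> norm_num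

/-- The diagonal norm `‖∑ a_i e_i‖ = max |a_i| exp (- x_i)`. -/
def diagNorm {n : ℕ} (e : Module.Basis (Fin n) k (Module.Dual k V)) (x : Fin n → ℝ) :
    GoldmanIwahori k V where
  toFun u := ⨆ i, trivAbs (e.repr u i) * Real.exp (-(x i))
  nonneg' u := Real.iSup_nonneg fun i => mul_nonneg (trivAbs_nonneg _) (Real.exp_pos _).le
  eq_zero_iff' u := by
    constructor
    · intro h
      apply e.repr.injective
      ext i
      by_contra hi
      have hi' : e.repr u i ≠ 0 := by simpa using hi
      have h1 := le_ciSup (f := fun i => trivAbs (e.repr u i) * Real.exp (-(x i)))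
        (Set.finite_range _).bddAbove i
      rw [h] at h1
      simp only [trivAbs_of_ne hi', one_mul] at h1
      exact absurd (Real.exp_pos (-(x i))) (not_lt.2 h1)
    · rintro rfl
      simp [trivAbs_zero]
  smul' c u := by
    rw [Real.mul_iSup_of_nonneg (trivAbs_nonneg c)]
    refine iSup_congr fun i => ?_
    simp [trivAbs_mul, mul_assoc]
  add_le' u w := by
    refine Real.iSup_le (fun i => ?_)
      (le_max_of_le_left (Real.iSup_nonneg fun i =>
        mul_nonneg (trivAbs_nonneg _) (Real.exp_pos _).le))
    have h1 := le_ciSup (f := fun i => trivAbs (e.repr u i) * Real.exp (-(x i)))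
      (Set.finite_range _).bddAbove i
    have h2 := le_ciSup (f := fun i => trivAbs (e.repr w i) * Real.exp (-(x i)))
      (Set.finite_range _).bddAbove i
    refine le_trans ?_ (max_le_max h1 h2)
    rw [← max_mul_of_nonneg _ _ (Real.exp_pos _).le]
    refine mul_le_mul_of_nonneg_right ?_ (Real.exp_pos _).le
    simpa using trivAbs_add_le (e.repr u i) (e.repr w i)

/-! ### The apartment of a basis -/

/-- The maximal torus of a basis `e` of the dual space: it consists of the `g` which are diagonal
with respect to the basis of `V` dual to `e`, i.e. `e_i ∘ g` is a multiple of `e_i` for all `i`. -/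
def diagSubgroup {n : ℕ} (e : Module.Basis (Fin n) k (Module.Dual k V)) : Subgroup (GLV k V) where
  carrier := {g | ∀ i, ∃ c : kˣ, ∀ v, e i (g v) = c * e i v}
  one_mem' i := ⟨1, by simp⟩
  mul_mem' {g h} hg hh i := by
    obtain ⟨c, hc⟩ := hg i
    obtain ⟨d, hd⟩ := hh i
    exact ⟨c * d, fun v => by simp [hc, hd, mul_assoc]⟩
  inv_mem' {g} hg i := by
    obtain ⟨c, hc⟩ := hg i
    refine ⟨c⁻¹, fun v => ?_⟩
    have := hc (g⁻¹ v)
    rw [← LinearEquiv.mul_apply, mul_inv_cancel] at this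
    rw [show e i v = c * e i (g⁻¹ v) from this]
    simp

lemma diag_exists_ne {n : ℕ} (e : Module.Basis (Fin n) k (Module.Dual k V)) (i : Fin n) :
    ∃ v, e i v ≠ 0 := by
  by_contra! h
  exact e.ne_zero i (LinearMap.ext h)

/-- The character `ε_i` of the torus of `e`, given by `e_i ∘ t = ε_i(t) e_i`. -/
def diagChar {n : ℕ} (e : Module.Basis (Fin n) k (Module.Dual k V)) (i : Fin n) :
    diagSubgroup e →* kˣ :=
  have key : ∀ (t : diagSubgroup e) (c : kˣ), (∀ v, e i (t.1 v) = c * e i v) →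
      Classical.choose (t.2 i) = c := by
    intro t c hc
    obtain ⟨v, hv⟩ := diag_exists_ne e i
    apply Units.ext
    apply mul_right_cancel₀ hv
    rw [← hc v, ← Classical.choose_spec (t.2 i) v]
  { toFun := fun t => Classical.choose (t.2 i)
    map_one' := key _ _ (by simp)
    map_mul' := fun s t => key _ _ (fun v => by
      have h1 := Classical.choose_spec (s.2 i) (t.1 v)
      have h2 := Classical.choose_spec (t.2 i) v
      rw [h2] at h1
      simpa [mul_assoc] using h1) }

lemma diagChar_spec {n : ℕ} (e : Module.Basis (Fin n) k (Module.Dual k V)) (i : Fin n)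
    (t : diagSubgroup e) (v : V) : e i (t.1 v) = diagChar e i t * e i v :=
  Classical.choose_spec (t.2 i) v

/-- The basis of `V` dual to a basis of the dual space. -/
def predual [FiniteDimensional k V] {n : ℕ} (e : Module.Basis (Fin n) k (Module.Dual k V)) :
    Module.Basis (Fin n) k V :=
  e.dualBasis.map (Module.evalEquiv k V).symm

lemma predual_repr [FiniteDimensional k V] {n : ℕ}
    (e : Module.Basis (Fin n) k (Module.Dual k V)) (v : V) (i : Fin n) :
    (predual e).repr v i = e i v := by
  simp [predual]

lemma det_diag [FiniteDimensional k V] {n : ℕ} (e : Module.Basis (Fin n) k (Module.Dual k V))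
    (t : diagSubgroup e) : LinearEquiv.det t.1 = ∏ i, diagChar e i t := by
  apply Units.ext
  rw [LinearEquiv.coe_det, ← LinearMap.det_toMatrix (predual e)]
  have : LinearMap.toMatrix (predual e) (predual e) (t.1 : V →ₗ[k] V) =
      Matrix.diagonal (fun i => (diagChar e i t : k)) := by
    ext i j
    rw [LinearMap.toMatrix_apply, predual_repr, Matrix.diagonal_apply]
    have h := diagChar_spec e i t (predual e j)
    rw [← predual_repr e (predual e j) i] at h
    simp only [LinearEquiv.coe_coe, h, Module.Basis.repr_self, Finsupp.single_apply]
    by_cases hij : i = j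
    · simp [hij]
    · simp [hij, Ne.symm hij]
  rw [this, Matrix.det_diagonal]
  simp

lemma diagChar_regular {n : ℕ} (e : Module.Basis (Fin n) k (Module.Dual k V)) (i : Fin n) :
    IsRegular (diagSubgroup e) (fun t => (diagChar e i t : k)) := by
  obtain ⟨v, hv⟩ := diag_exists_ne e i
  refine ⟨(e i v)⁻¹ • fun g => e i (g v), Subalgebra.smul_mem (CoordRing k V)
    (Algebra.subset_adjoin (Or.inl ⟨e i, v, rfl⟩)) _, fun t => ?_⟩
  rw [Pi.smul_apply, diagChar_spec, smul_eq_mul]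
  field_simp

lemma diagChar_inv_regular [FiniteDimensional k V] {n : ℕ}
    (e : Module.Basis (Fin n) k (Module.Dual k V)) (i : Fin n) :
    IsRegular (diagSubgroup e) (fun t => (((diagChar e i t)⁻¹ : kˣ) : k)) := by
  choose f hf hf' using diagChar_regular e
  refine ⟨(fun g => (((LinearEquiv.det g)⁻¹ : kˣ) : k)) * ∏ j ∈ Finset.univ.erase i, f j,
    mul_mem (Algebra.subset_adjoin (Or.inr rfl))
      (Subalgebra.prod_mem (CoordRing k V) fun j _ => hf j), fun t => ?_⟩
  rw [Pi.mul_apply, Finset.prod_apply, det_diag]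
  simp only [← hf' _ t]
  rw [← Finset.mul_prod_erase Finset.univ (fun j => diagChar e j t) (Finset.mem_univ i), mul_inv,
    Units.val_mul, mul_assoc, ← Units.coe_prod, ← Units.val_mul, inv_mul_cancel]
  simp

/-- The `ε_i` identify the torus of `e` with `𝔾ₘ ^ n`. -/
lemma diag_bijective [FiniteDimensional k V] {n : ℕ}
    (e : Module.Basis (Fin n) k (Module.Dual k V)) :
    Function.Bijective (MonoidHom.mk' (fun (t : diagSubgroup e) (i : Fin n) => diagChar e i t)
      (fun s t => by funext i; simp)) := by
  constructor
  · intro s t hst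
    apply Subtype.ext
    apply LinearEquiv.ext
    intro v
    apply (predual e).repr.injective
    ext i
    have h : diagChar e i s = diagChar e i t := congrFun hst i
    rw [predual_repr, predual_repr, diagChar_spec, diagChar_spec, h]
  · intro s
    let g : GLV k V := (predual e).equivFun.trans
      ((LinearEquiv.piCongrRight fun i => LinearEquiv.smulOfUnit (s i)).trans
        (predual e).equivFun.symm)
    have hg : ∀ i v, e i (g v) = s i * e i v := by
      intro i v
      have h1 : (predual e).equivFun (g v) i = s i * (predual e).equivFun v i := by
        simp only [g, LinearEquiv.trans_apply, LinearEquiv.apply_symm_apply]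
        rfl
      simpa only [Module.Basis.equivFun_apply, predual_repr] using h1
    refine ⟨⟨g, fun i => ⟨s i, hg i⟩⟩, ?_⟩
    funext i
    obtain ⟨v, hv⟩ := diag_exists_ne e i
    apply Units.ext
    apply mul_right_cancel₀ hv
    rw [← hg]
    exact (diagChar_spec e i ⟨g, fun i => ⟨s i, hg i⟩⟩ v).symm

lemma diag_isTorus [FiniteDimensional k V] {n : ℕ}
    (e : Module.Basis (Fin n) k (Module.Dual k V)) : IsTorus (diagSubgroup e) := by
  let ψ := MulEquiv.ofBijective _ (diag_bijective e)
  have hψ : ∀ s i, diagChar e i (ψ.symm s) = s i := fun s i =>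
    congrFun (ψ.apply_symm_apply s) i
  refine ⟨n, ψ.symm, fun h => ⟨fun hh => ?_, ?_⟩⟩
  · refine Algebra.adjoin_induction
      (p := fun h _ => ∃ f ∈ CoordRing k V, ∀ s, h s = f (ψ.symm s)) ?_ ?_ ?_ ?_ hh
    · rintro _ (⟨i, rfl⟩ | ⟨i, rfl⟩)
      · obtain ⟨f, hf, hf'⟩ := diagChar_regular e i
        refine ⟨f, hf, fun s => ?_⟩
        rw [← hf']
        simp only [hψ]
      · obtain ⟨f, hf, hf'⟩ := diagChar_inv_regular e i
        refine ⟨f, hf, fun s => ?_⟩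
        rw [← hf']
        simp only [hψ]
    · intro c
      exact ⟨algebraMap k _ c, Subalgebra.algebraMap_mem _ c, fun s => rfl⟩
    · rintro x y _ _ ⟨f, hf, hf'⟩ ⟨g, hg, hg'⟩
      exact ⟨f + g, add_mem hf hg, fun s => by simp [hf', hg']⟩
    · rintro x y _ _ ⟨f, hf, hf'⟩ ⟨g, hg, hg'⟩
      exact ⟨f * g, mul_mem hf hg, fun s => by simp [hf', hg']⟩
  · rintro ⟨f, hf, hf'⟩
    have hh : h = fun s => f (ψ.symm s) := funext hf'
    rw [hh]
    refine Algebra.adjoin_induction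
      (p := fun f _ => (fun s => f (ψ.symm s : GLV k V)) ∈ Laurent k n) ?_ ?_ ?_ ?_ hf
    · rintro _ (⟨l, v, rfl⟩ | rfl)
      · have h1 : (fun s => l ((ψ.symm s).1 v)) =
            ∑ i, (l (predual e i) * e i v) • (fun (s : Fin n → kˣ) => (s i : k)) := by
          funext s
          have h2 := congrArg l ((predual e).sum_repr ((ψ.symm s).1 v))
          rw [← h2, map_sum, Finset.sum_apply]
          refine Finset.sum_congr rfl fun i _ => ?_
          rw [map_smul, predual_repr, diagChar_spec, hψ, Pi.smul_apply, smul_eq_mul, smul_eq_mul]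
          ring
        rw [h1]
        exact sum_mem fun i _ => Subalgebra.smul_mem (Laurent k n)
          (Algebra.subset_adjoin (Or.inl ⟨i, rfl⟩)) _
      · have h1 : (fun s => (((LinearEquiv.det (ψ.symm s).1)⁻¹ : kˣ) : k)) =
            ∏ i, (fun (s : Fin n → kˣ) => (((s i)⁻¹ : kˣ) : k)) := by
          funext s
          rw [det_diag, Finset.prod_apply, ← Finset.prod_inv_distrib, Units.coe_prod]
          simp only [hψ]
        rw [h1]
        exact Subalgebra.prod_mem (Laurent k n) fun i _ => Algebra.subset_adjoin (Or.inr ⟨i, rfl⟩)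
    · intro c
      exact Subalgebra.algebraMap_mem _ c
    · intro x y _ _ hx hy
      exact add_mem hx hy
    · intro x y _ _ hx hy
      exact mul_mem hx hy

/-- The maximal torus of a basis `e` of the dual space. -/
def diagTorus [FiniteDimensional k V] {n : ℕ} (e : Module.Basis (Fin n) k (Module.Dual k V)) :
    Torus k V :=
  ⟨diagSubgroup e, diag_isTorus e⟩

/-- The coordinates `a(ε_i)` of a point `a` of `T^trop`, for the torus `T` of the basis `e`. -/
def diagCoord [FiniteDimensional k V] {n : ℕ} (e : Module.Basis (Fin n) k (Module.Dual k V))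
    (a : Trop (diagTorus e).1) (i : Fin n) : ℝ :=
  a (Additive.ofMul ⟨diagChar e i, diagChar_regular e i, diagChar_inv_regular e i⟩)

/-- The point `t_a` of the building, for a torus `T` of `GL(V)` and `a ∈ T^trop`. -/
def point [FiniteDimensional k V] (T : Torus k V) (a : Trop T.1) : BerkBuilding k V :=
  ⟨theta (Quot.mk _ ⟨T, a⟩), ⟨_, rfl⟩⟩

end GLBuild

end

/-!
The comparison map `α` reads off the values of a point of the building on matrix coefficients
`g ↦ l (g v)`: for `v ≠ 0` the point `t_a ∗ g₀` takes the value `‖l‖_{e,a}` there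
(`point_matrixCoeff`), because the weights of this function under left translation by the torus of
`e` are the `ε_i` for which `l` has a nonzero `i`-th coordinate. Every torus is simultaneously
diagonalizable, so every point of the building comes from the torus of some basis
(`exists_eq_point`). Together these facts show that `α` exists, is unique, and is continuous.

For injectivity, let `t_a` and `t_b` be points in the apartments of `e` and `e'` that induce the
same norm on the dual space. Expand `f (t t' x)` in products `χ^m(t) χ^m'(t')` of characters of the
two tori. Equality of the norms says that only pairs with `a(m) ≤ b(m')` occur when `f` is a matrix
coefficient, and comparing the sums of the coordinates through a nonzero term of a determinant gives
the same for the inverse determinant. Such pairs form a submonoid, so their span is a subalgebra,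
and the claim holds for every regular `f` (`mem_dominatedSpan`). It bounds the value of `t_b ∗ g₀`
at `f` by that of `t_a ∗ g₀` (`point_le_of_diagNorm_eq`), and the situation is symmetric. This avoids
any discussion of flags and parabolic subgroups.

For surjectivity, the balls of a norm over a trivially valued field are subspaces, so a norm attains
its minimum on every coset of a subspace, and a minimizing vector is orthogonal to the subspace.
Hence an orthogonal basis exists (`exists_eq_diagNorm`). The coordinates `a(ε_i)` can be prescribed
because the `ε_i` are independent in the character lattice and `ℝ` is divisible
(`exists_diagCoord_eq`).
-/

noncomputable section

namespace GLBuild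

universe u v

variable {k : Type u} {V : Type v} [Field k] [AddCommGroup V] [Module k V]

/-! ### Tori are simultaneously diagonalizable -/

/-- The matrix coefficient `g ↦ l (g v)`. -/
def matrixCoeff (l : Module.Dual k V) (v : V) : CoordRing k V :=
  ⟨fun g => l (g v), Algebra.subset_adjoin (Or.inl ⟨l, v, rfl⟩)⟩

lemma coeffs_apply_eq (T : Torus k V) (f : CoordRing k V) (t : T.1) :
    f.1 t = (coeffs T f).sum (fun m a => a * (m.1 t : k)) :=
  coeffs_spec T f t

/-- Translation by an element `s` of `T` multiplies the coefficient of `χ^m` by `χ^m(s)`. -/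
lemma coeffs_of_torus_translate (T : Torus k V) {f f' : CoordRing k V} (s : T.1)
    (h : ∀ t : T.1, f'.1 t = f.1 (t * s)) (m : Characters T.1) :
    coeffs T f' m = coeffs T f m * (m.1 s : k) := by
  classical
  have h1 : coeffs T f' =
      (coeffs T f).sum (fun m c => Finsupp.single m (c * (m.1 s : k))) := by
    refine coeffs_eq fun t => ?_
    rw [h, Finsupp.sum_sum_index (by simp) (by intros; ring),
      ← Subgroup.coe_mul, coeffs_apply_eq]
    refine Finsupp.sum_congr fun m _ => ?_
    rw [Finsupp.sum_single_index (by simp), map_mul, Units.val_mul]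
    ring
  rw [h1, Finsupp.sum_apply]
  simp only [Finsupp.single_apply]
  rw [Finsupp.sum, Finset.sum_ite_eq']
  split_ifs with hm
  · rfl
  · rw [Finsupp.notMem_support_iff.1 hm, zero_mul]

/-- The coefficient of `χ^m` in `l (t v)`, as a linear functional of `l`. -/
def weightFunctional (T : Torus k V) (m : Characters T.1) (v : V) :
    Module.Dual k (Module.Dual k V) where
  toFun l := coeffs T (matrixCoeff l v) m
  map_add' l l' := by
    rw [← Finsupp.add_apply]
    congr 1
    refine coeffs_eq fun t => ?_
    rw [Finsupp.sum_add_index' (by simp) (by intros; ring), ← coeffs_apply_eq, ← coeffs_apply_eq]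
    rfl
  map_smul' c l := by
    rw [RingHom.id_apply, ← Finsupp.smul_apply]
    congr 1
    refine coeffs_eq fun t => ?_
    rw [Finsupp.sum_smul_index (by simp)]
    simp only [mul_assoc]
    rw [← Finsupp.mul_sum, ← coeffs_apply_eq]
    rfl

/-- The component of weight `m` of a vector `v` under the action of `T`. -/
def weightVector [FiniteDimensional k V] (T : Torus k V) (m : Characters T.1) (v : V) : V :=
  (Module.evalEquiv k V).symm (weightFunctional T m v)

lemma apply_weightVector [FiniteDimensional k V] (T : Torus k V) (m : Characters T.1) (v : V)
    (l : Module.Dual k V) : l (weightVector T m v) = coeffs T (matrixCoeff l v) m := by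
  simp [weightVector, weightFunctional]

lemma torus_apply_weightVector [FiniteDimensional k V] (T : Torus k V) (m : Characters T.1)
    (v : V) (s : T.1) :
    (s : GLV k V) (weightVector T m v) = (m.1 s : k) • weightVector T m v := by
  refine (Module.forall_dual_apply_eq_zero_iff k _).1 ?_ |> sub_eq_zero.1
  intro l
  rw [map_sub, map_smul, smul_eq_mul, sub_eq_zero, apply_weightVector]
  have h1 : l ((s : GLV k V) (weightVector T m v)) =
      coeffs T (matrixCoeff (l ∘ₗ (s : GLV k V).toLinearMap) v) m :=
    apply_weightVector T m v (l ∘ₗ (s : GLV k V).toLinearMap)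
  rw [h1, coeffs_of_torus_translate T (f := matrixCoeff l v) s ?_ m, mul_comm]
  intro t
  change l (s.1 (t.1 v)) = l (((t * s : T.1) : GLV k V) v)
  -- a torus is commutative
  obtain ⟨r, φ, -⟩ := T.2
  have hc : t * s = s * t := φ.symm.injective (by rw [map_mul, map_mul, mul_comm])
  rw [hc]
  rfl

/-- Every torus of `GL(V)` lies in the maximal torus of some basis of the dual space: the weight
vectors span `V`, as a functional `l` killing all of them satisfies `l (t v) = 0` on the torus. -/
lemma exists_le_diagSubgroup [FiniteDimensional k V] {n : ℕ} (hn : Module.finrank k V = n)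
    (T : Torus k V) :
    ∃ e : Module.Basis (Fin n) k (Module.Dual k V), T.1 ≤ diagSubgroup e := by
  have hspan : ⊤ ≤ Submodule.span k {w | ∃ m v, w = weightVector T m v} := by
    by_contra hlt
    obtain ⟨l, hl, hl'⟩ := Submodule.exists_dual_map_eq_bot_of_lt_top
      (lt_of_le_not_ge le_top hlt) inferInstance
    refine hl (LinearMap.ext fun v => ?_)
    have h0 : coeffs T (matrixCoeff l v) = 0 := by
      ext m
      rw [← apply_weightVector, Finsupp.zero_apply, ← Submodule.mem_bot k, ← hl']
      exact Submodule.mem_map_of_mem (Submodule.subset_span ⟨m, v, rfl⟩)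
    have h1 := coeffs_apply_eq T (matrixCoeff l v) 1
    rw [h0, Finsupp.sum_zero_index] at h1
    exact h1
  let b := Module.Basis.ofSpan hspan
  let b' : Module.Basis (Fin n) k V := b.reindex (Fintype.equivFinOfCardEq
    (by rw [← hn, Module.finrank_eq_card_basis b]))
  have hb' : ∀ j, ∃ m v, b' j = weightVector T m v := fun j => by
    rw [Module.Basis.reindex_apply]
    exact Module.Basis.ofSpan_subset hspan ⟨_, rfl⟩
  choose m v hm using hb'
  refine ⟨b'.dualBasis, fun t ht i => ⟨(m i).1 ⟨t, ht⟩, fun w => ?_⟩⟩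
  have h1 : b'.dualBasis i ∘ₗ t.toLinearMap = (((m i).1 ⟨t, ht⟩ : kˣ) : k) • b'.dualBasis i := by
    refine b'.ext fun j => ?_
    have h2 : t (b' j) = ((m j).1 ⟨t, ht⟩ : k) • b' j := by
      rw [hm j]
      exact torus_apply_weightVector T (m j) (v j) ⟨t, ht⟩
    rw [LinearMap.comp_apply, LinearEquiv.coe_coe, h2, map_smul, LinearMap.smul_apply,
      Module.Basis.dualBasis_apply_self]
    split_ifs with hij
    · rw [hij]
    · simp
  exact LinearMap.congr_fun h1 w

/-- Every point of the building lies in the apartment of a basis. -/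
lemma exists_eq_point [FiniteDimensional k V] {n : ℕ} (hn : Module.finrank k V = n)
    (p : BerkBuilding k V) :
    ∃ (e : Module.Basis (Fin n) k (Module.Dual k V)) (a : Trop (diagTorus e).1),
      p = point (diagTorus e) a := by
  obtain ⟨_, ⟨⟨T, a⟩, rfl⟩⟩ := p
  obtain ⟨e, he⟩ := exists_le_diagSubgroup hn T
  have he' : T.1 ≤ (diagTorus e).1 := he
  refine ⟨e, tropMap he' a, Subtype.ext ?_⟩
  have h : (Quot.mk _ ⟨T, a⟩ : Colim k V) = Quot.mk _ ⟨diagTorus e, tropMap he' a⟩ :=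
    Quot.sound ⟨he', rfl⟩
  exact congrArg theta h

/-! ### Values of points of the building on matrix coefficients -/

lemma exists_linearEquiv_apply_eq {v w : V} (hv : v ≠ 0) (hw : w ≠ 0) :
    ∃ g : GLV k V, g v = w := by
  have : MulAction.IsPretransitive (GLV k V) (Projectivization k V) :=
    MulAction.isPretransitive_of_is_two_pretransitive
  obtain ⟨g, hg⟩ := MulAction.exists_smul_eq (GLV k V) (Projectivization.mk k v hv)
    (Projectivization.mk k w hw)
  rw [Projectivization.smul_mk, Projectivization.mk_eq_mk_iff'] at hg
  obtain ⟨c, hc⟩ := hg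
  have hc' : c • w = g v := hc
  have hc0 : c ≠ 0 := by
    rintro rfl
    rw [zero_smul] at hc'
    exact hv (g.map_eq_zero_iff.1 hc'.symm)
  exact ⟨g.trans (LinearEquiv.smulOfNeZero k V c⁻¹ (inv_ne_zero hc0)), by simp [← hc', hc0]⟩

/-- The character `ε_i` as an element of the character lattice of the torus of `e`. -/
def diagCharacter [FiniteDimensional k V] {n : ℕ}
    (e : Module.Basis (Fin n) k (Module.Dual k V)) (i : Fin n) : Characters (diagTorus e).1 :=
  ⟨diagChar e i, diagChar_regular e i, diagChar_inv_regular e i⟩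

lemma dual_apply_eq_sum {n : ℕ} (e : Module.Basis (Fin n) k (Module.Dual k V))
    (l : Module.Dual k V) (v : V) : l v = ∑ i, e.repr l i * e i v := by
  conv_lhs => rw [← e.sum_repr l, LinearMap.sum_apply]
  simp only [LinearMap.smul_apply, smul_eq_mul]

lemma coeffs_translate_matrixCoeff [FiniteDimensional k V] {n : ℕ}
    (e : Module.Basis (Fin n) k (Module.Dual k V)) (l : Module.Dual k V) (v : V) (x : GLV k V) :
    coeffs (diagTorus e) (translate (matrixCoeff l v) x) =
      ∑ i, Finsupp.single (diagCharacter e i) (e.repr l i * e i (x v)) := by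
  refine coeffs_eq fun t => ?_
  rw [← Finsupp.sum_finsetSum_index (by simp) (by intros; ring)]
  change l (t.1 (x v)) = _
  rw [dual_apply_eq_sum e]
  refine Finset.sum_congr rfl fun i _ => ?_
  rw [Finsupp.sum_single_index (by simp), diagChar_spec e i t, mul_assoc]
  congr 1
  exact mul_comm _ _

lemma point_apply [FiniteDimensional k V] (T : Torus k V) (a : Trop T.1) (f : CoordRing k V) :
    (point T a).1 f =
      sSup ((fun m : Characters T.1 => Real.exp (-(a (Additive.ofMul m)))) '' weights T f) :=
  thetaAux_eq T a f

/-- The point `t_a` takes the value `‖l‖_{e,a}` on every matrix coefficient `g ↦ l (g v)` with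
`v ≠ 0`. -/
lemma point_matrixCoeff [FiniteDimensional k V] {n : ℕ}
    (e : Module.Basis (Fin n) k (Module.Dual k V)) (a : Trop (diagTorus e).1)
    (l : Module.Dual k V) {v : V} (hv : v ≠ 0) :
    (point (diagTorus e) a).1 (matrixCoeff l v) = (diagNorm e (diagCoord e a)).toFun l := by
  classical
  rw [point_apply]
  change _ = ⨆ i, trivAbs (e.repr l i) * Real.exp (-(diagCoord e a i))
  have hle : ∀ m ∈ weights (diagTorus e) (matrixCoeff l v),
      Real.exp (-(a (Additive.ofMul m))) ≤
        ⨆ i, trivAbs (e.repr l i) * Real.exp (-(diagCoord e a i)) := by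
    rintro m ⟨x, hx⟩
    rw [coeffs_translate_matrixCoeff, Finsupp.finsetSum_apply] at hx
    obtain ⟨i, -, hi⟩ := Finset.exists_ne_zero_of_sum_ne_zero hx
    rw [Finsupp.single_apply] at hi
    split_ifs at hi with him
    · refine le_trans (le_of_eq ?_) (le_ciSup (Set.finite_range _).bddAbove i)
      rw [trivAbs_of_ne (left_ne_zero_of_mul hi), one_mul, ← him]
      rfl
    · exact absurd rfl hi
  have hnn : 0 ≤ sSup ((fun m : Characters (diagTorus e).1 =>
      Real.exp (-(a (Additive.ofMul m)))) '' weights (diagTorus e) (matrixCoeff l v)) := by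
    apply Real.sSup_nonneg
    rintro _ ⟨m, -, rfl⟩
    exact (Real.exp_pos _).le
  apply le_antisymm
  · refine Real.sSup_le ?_ ((diagNorm e (diagCoord e a)).nonneg' l)
    rintro _ ⟨m, hm, rfl⟩
    exact hle m hm
  · refine Real.iSup_le (fun i => ?_) hnn
    by_cases hi : e.repr l i = 0
    · rw [hi, trivAbs_zero, zero_mul]
      exact hnn
    rw [trivAbs_of_ne hi, one_mul]
    obtain ⟨x, hx⟩ : ∃ x, coeffs (diagTorus e) (translate (matrixCoeff l v) x)
        (diagCharacter e i) ≠ 0 := by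
      -- moving `v` to a vector on which only the `i`-th coordinate is nonzero
      obtain ⟨x, hx⟩ := exists_linearEquiv_apply_eq (k := k) hv ((predual e).ne_zero i)
      refine ⟨x, ?_⟩
      rw [coeffs_translate_matrixCoeff, Finset.sum_eq_single i]
      · rw [Finsupp.single_eq_same, hx, ← predual_repr]
        simpa using hi
      · intro j _ hj
        rw [hx, ← predual_repr, Module.Basis.repr_self, Finsupp.single_eq_of_ne hj, mul_zero,
          Finsupp.single_zero]
      · simp
    refine le_csSup ⟨⨆ i, trivAbs (e.repr l i) * Real.exp (-(diagCoord e a i)), ?_⟩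
      ⟨diagCharacter e i, ⟨x, hx⟩, rfl⟩
    · rintro _ ⟨m, hm, rfl⟩
      exact hle m hm

/-! ### A point of the building is determined by its norm on the dual space -/

/-- The pairs of characters `(m, m')` with `a(m) ≤ b(m')`. -/
def dominatedPairs {T T' : Torus k V} (a : Trop T.1) (b : Trop T'.1) :
    Submonoid (Characters T.1 × Characters T'.1) where
  carrier := {q | a (Additive.ofMul q.1) ≤ b (Additive.ofMul q.2)}
  one_mem' := by simp
  mul_mem' {p q} hp hq := by
    simp only [Set.mem_ofPred_eq, Prod.fst_mul, Prod.snd_mul, ofMul_mul, map_add] at *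
    exact add_le_add hp hq

/-- A pair of characters of `T` and `T'` as a function on `T × T'`. -/
def pairFun (T T' : Torus k V) : Characters T.1 × Characters T'.1 →* (T.1 × T'.1 → k) where
  toFun q t := (q.1.1 t.1 : k) * (q.2.1 t.2 : k)
  map_one' := by
    funext t
    simp
  map_mul' p q := by
    funext t
    simp only [Prod.fst_mul, Prod.snd_mul, Subgroup.coe_mul, MonoidHom.mul_apply, Units.val_mul,
      Pi.mul_apply]
    ring

/-- The span of the functions `χ^m(t) χ^m'(t')` with `a(m) ≤ b(m')`. -/
def dominatedSpan {T T' : Torus k V} (a : Trop T.1) (b : Trop T'.1) :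
    Subalgebra k (T.1 × T'.1 → k) :=
  (MonoidAlgebra.lift k _ _ ((pairFun T T').comp (dominatedPairs a b).subtype)).range

lemma pairFun_mem_dominatedSpan {T T' : Torus k V} {a : Trop T.1} {b : Trop T'.1}
    {q : Characters T.1 × Characters T'.1} (hq : q ∈ dominatedPairs a b) :
    pairFun T T' q ∈ dominatedSpan a b :=
  ⟨MonoidAlgebra.of k _ ⟨q, hq⟩, by simp⟩

lemma exists_of_mem_dominatedSpan {T T' : Torus k V} {a : Trop T.1} {b : Trop T'.1}
    {F : T.1 × T'.1 → k} (hF : F ∈ dominatedSpan a b) :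
    ∃ C : Characters T.1 × Characters T'.1 →₀ k, (∀ q, C q ≠ 0 → q ∈ dominatedPairs a b) ∧
      ∀ t t', F (t, t') = C.sum fun q c => c * ((q.1.1 t : k) * (q.2.1 t' : k)) := by
  classical
  obtain ⟨D, rfl⟩ := hF
  refine ⟨D.coeff.mapDomain Subtype.val, fun q hq => ?_, fun t t' => ?_⟩
  · have h1 := Finsupp.mapDomain_support (Finsupp.mem_support_iff.2 hq)
    obtain ⟨p, -, rfl⟩ := Finset.mem_image.1 h1
    exact p.2
  · rw [Finsupp.sum_mapDomain_index (by simp) (by intros; ring)]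
    change (MonoidAlgebra.lift k _ _ ((pairFun T T').comp (dominatedPairs a b).subtype)) D (t, t')
      = _
    rw [MonoidAlgebra.lift_apply, Finsupp.sum, Finset.sum_apply]
    rfl

/-- If `f (t t' x)` only involves pairs of characters with `a(m) ≤ b(m')`, then every weight `m'`
of `f` for `T'` seen at `x` dominates a weight of `f` for `T`. -/
lemma exists_weight_le [FiniteDimensional k V] {T T' : Torus k V} {a : Trop T.1}
    {b : Trop T'.1} {f : CoordRing k V} {x : GLV k V}
    (hf : (fun t : T.1 × T'.1 => f.1 (t.1 * t.2 * x)) ∈ dominatedSpan a b)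
    {m' : Characters T'.1} (hm' : coeffs T' (translate f x) m' ≠ 0) :
    ∃ m ∈ weights T f, a (Additive.ofMul m) ≤ b (Additive.ofMul m') := by
  classical
  obtain ⟨C, hC, h⟩ := exists_of_mem_dominatedSpan hf
  have h1 : coeffs T' (translate f x) = C.mapDomain Prod.snd := by
    refine coeffs_eq fun t' => ?_
    rw [Finsupp.sum_mapDomain_index (by simp) (by intros; ring)]
    have h0 := h 1 t'
    simp only [map_one, Units.val_one, one_mul] at h0
    exact h0
  have h2 : ∀ t' : T'.1, coeffs T (translate f (t' * x)) = C.curry.mapRange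
      (fun d => d.sum fun n c => c * (n.1 t' : k)) Finsupp.sum_zero_index := by
    intro t'
    refine coeffs_eq fun t => ?_
    rw [Finsupp.sum_mapRange_index (by simp)]
    have h3 := h t t'
    rw [mul_assoc] at h3
    refine Eq.trans h3 ?_
    rw [← Finsupp.sum_curry_index C fun m n c => c * ((m.1 t : k) * (n.1 t' : k))]
    refine Finsupp.sum_congr fun m _ => ?_
    rw [Finsupp.sum_mul]
    refine Finsupp.sum_congr fun n _ => ?_
    ring
  rw [h1] at hm'
  obtain ⟨q, hq, rfl⟩ := Finset.mem_image.1
    (Finsupp.mapDomain_support (Finsupp.mem_support_iff.2 hm'))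
  rw [Finsupp.mem_support_iff] at hq
  refine ⟨q.1, ?_, hC q hq⟩
  by_contra hw
  have hz : C.curry q.1 = 0 := by
    refine expansion_unique fun t' => ?_
    rw [Finsupp.sum_zero_index]
    by_contra hne
    refine hw ⟨t' * x, ?_⟩
    rw [h2, Finsupp.mapRange_apply]
    exact hne
  apply hq
  have := DFunLike.congr_fun hz q.2
  simpa using this

lemma finite_weights [FiniteDimensional k V] (T : Torus k V) (f : CoordRing k V) :
    (weights T f).Finite := by
  obtain ⟨n, c, b, -, h⟩ := exists_comul f
  refine (Set.finite_iUnion fun i => (coeffs T (c i)).support.finite_toSet).subset ?_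
  rintro m ⟨x, hx⟩
  rw [coeffs_sum T (translate f x) (fun i => (b i).1 x) c (fun t => h t x),
    Finsupp.finsetSum_apply] at hx
  obtain ⟨i, -, hi⟩ := Finset.exists_ne_zero_of_sum_ne_zero hx
  refine Set.mem_iUnion.2 ⟨i, ?_⟩
  simp only [Finset.mem_coe, Finsupp.mem_support_iff]
  exact right_ne_zero_of_mul hi

lemma point_le_point [FiniteDimensional k V] {T T' : Torus k V} {a : Trop T.1}
    {b : Trop T'.1} {f : CoordRing k V}
    (hf : ∀ m' ∈ weights T' f, ∃ m ∈ weights T f, a (Additive.ofMul m) ≤ b (Additive.ofMul m')) :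
    (point T' b).1 f ≤ (point T a).1 f := by
  rw [point_apply, point_apply]
  refine Real.sSup_le ?_ (Real.sSup_nonneg ?_)
  · rintro _ ⟨m', hm', rfl⟩
    obtain ⟨m, hm, hle⟩ := hf m' hm'
    exact (Real.exp_le_exp.2 (neg_le_neg hle)).trans
      (le_csSup ((finite_weights T f).image _).bddAbove ⟨m, hm, rfl⟩)
  · rintro _ ⟨m, -, rfl⟩
    exact (Real.exp_pos _).le

/-- Comparing two diagonal norms bounds the coordinates of each basis along the other. -/
lemma coord_le_of_diagNorm_eq {n : ℕ} {e e' : Module.Basis (Fin n) k (Module.Dual k V)}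
    {x x' : Fin n → ℝ} (h : diagNorm e x = diagNorm e' x') {i j : Fin n}
    (hij : e'.repr (e i) j ≠ 0) : x i ≤ x' j := by
  have h1 : (diagNorm e x).toFun (e i) ≤ Real.exp (-(x i)) := by
    refine Real.iSup_le (fun l => ?_) (Real.exp_pos _).le
    rw [Module.Basis.repr_self, Finsupp.single_apply]
    split_ifs with hl
    · rw [trivAbs_of_ne one_ne_zero, one_mul, hl]
    · rw [trivAbs_zero, zero_mul]
      exact (Real.exp_pos _).le
  have h2 : Real.exp (-(x' j)) ≤ (diagNorm e' x').toFun (e i) := by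
    refine le_trans (le_of_eq ?_) (le_ciSup (Set.finite_range _).bddAbove j)
    rw [trivAbs_of_ne hij, one_mul]
  rw [← h] at h2
  simpa using h2.trans h1

/-- Applied in both directions, this shows that the determinant takes the same value at two points
with the same norm. -/
lemma sum_coord_le_of_diagNorm_eq {n : ℕ} {e e' : Module.Basis (Fin n) k (Module.Dual k V)}
    {x x' : Fin n → ℝ} (h : diagNorm e x = diagNorm e' x') : ∑ i, x i ≤ ∑ i, x' i := by
  -- a nonzero term of the determinant of the base change matrix matches up the coordinates
  have hdet : (e'.toMatrix e).det ≠ 0 := by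
    have := (e'.isUnit_det e)
    rw [Module.Basis.det_apply] at this
    exact this.ne_zero
  rw [Matrix.det_apply] at hdet
  obtain ⟨σ, -, hσ⟩ := Finset.exists_ne_zero_of_sum_ne_zero hdet
  have hσ' : ∀ i, e'.toMatrix e (σ i) i ≠ 0 := fun i h0 =>
    hσ (by rw [Finset.prod_eq_zero (f := fun i => e'.toMatrix e (σ i) i) (Finset.mem_univ i) h0,
      smul_zero])
  calc ∑ i, x i ≤ ∑ i, x' (σ i) :=
        Finset.sum_le_sum fun i _ => coord_le_of_diagNorm_eq h (hσ' i)
    _ = ∑ i, x' i := Equiv.sum_comp σ x'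

lemma apply_prod_diagCharacter_inv [FiniteDimensional k V] {n : ℕ}
    (e : Module.Basis (Fin n) k (Module.Dual k V)) (a : Trop (diagTorus e).1) :
    a (Additive.ofMul (∏ i, (diagCharacter e i)⁻¹)) = -∑ i, diagCoord e a i := by
  rw [ofMul_prod, map_sum, ← Finset.sum_neg_distrib]
  refine Finset.sum_congr rfl fun i _ => ?_
  rw [ofMul_inv, map_neg]
  rfl

/-- The inverse of the determinant is the character `∏ ε_i⁻¹` on the torus of a basis. -/
lemma det_inv_eq [FiniteDimensional k V] {n : ℕ}
    (e : Module.Basis (Fin n) k (Module.Dual k V)) (t : (diagTorus e).1) :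
    (LinearEquiv.det t.1)⁻¹ = (∏ i, (diagCharacter e i)⁻¹ : Characters (diagTorus e).1).1 t := by
  rw [det_diag e t, ← Finset.prod_inv_distrib]
  simp [diagCharacter]
  exact (MonoidHom.finsetProd_apply _ _ _).symm

/-- If two points induce the same norm on the dual space, then `f (t t' x)` only involves pairs of
characters with `a(m) ≤ b(m')`; it is enough to check this for generators of `k[GL(V)]`. -/
lemma mem_dominatedSpan [FiniteDimensional k V] {n : ℕ}
    {e e' : Module.Basis (Fin n) k (Module.Dual k V)} {a : Trop (diagTorus e).1}
    {b : Trop (diagTorus e').1}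
    (h : diagNorm e (diagCoord e a) = diagNorm e' (diagCoord e' b)) (x : GLV k V)
    (f : CoordRing k V) :
    (fun t : (diagTorus e).1 × (diagTorus e').1 => f.1 (t.1 * t.2 * x)) ∈ dominatedSpan a b := by
  obtain ⟨f, hf⟩ := f
  refine Algebra.adjoin_induction (p := fun f _ =>
    (fun t : (diagTorus e).1 × (diagTorus e').1 => f (t.1 * t.2 * x)) ∈ dominatedSpan a b)
    ?_ ?_ ?_ ?_ hf
  · rintro _ (⟨l, v, rfl⟩ | rfl)
    · have h1 : (fun t : (diagTorus e).1 × (diagTorus e').1 => l ((t.1 * t.2 * x : GLV k V) v)) =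
          ∑ i, ∑ j, (e.repr l i * e'.repr (e i) j * e' j (x v)) •
            pairFun _ _ (diagCharacter e i, diagCharacter e' j) := by
        funext t
        change l (t.1.1 (t.2.1 (x v))) = _
        rw [dual_apply_eq_sum e, Finset.sum_apply]
        refine Finset.sum_congr rfl fun i _ => ?_
        rw [diagChar_spec e i t.1, dual_apply_eq_sum e', Finset.sum_apply, Finset.mul_sum,
          Finset.mul_sum]
        refine Finset.sum_congr rfl fun j _ => ?_
        rw [diagChar_spec e' j t.2, Pi.smul_apply, smul_eq_mul]
        change _ = _ * ((diagChar e i t.1 : k) * (diagChar e' j t.2 : k))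
        ring
      rw [h1]
      refine sum_mem fun i _ => sum_mem fun j _ => ?_
      by_cases hij : e'.repr (e i) j = 0
      · rw [hij, mul_zero, zero_mul, zero_smul]
        exact zero_mem _
      · exact Subalgebra.smul_mem _
          (pairFun_mem_dominatedSpan (coord_le_of_diagNorm_eq h hij)) _
    · have h1 : (fun t : (diagTorus e).1 × (diagTorus e').1 =>
          (((LinearEquiv.det (t.1 * t.2 * x : GLV k V))⁻¹ : kˣ) : k)) =
          (((LinearEquiv.det x)⁻¹ : kˣ) : k) •
            pairFun _ _ (∏ i, (diagCharacter e i)⁻¹, ∏ i, (diagCharacter e' i)⁻¹) := by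
        funext t
        rw [map_mul, map_mul, mul_inv, mul_inv, det_inv_eq e, det_inv_eq e', mul_comm,
          Units.val_mul, Units.val_mul]
        rfl
      rw [h1]
      refine Subalgebra.smul_mem _ (pairFun_mem_dominatedSpan ?_) _
      change a _ ≤ b _
      rw [apply_prod_diagCharacter_inv, apply_prod_diagCharacter_inv]
      exact neg_le_neg (sum_coord_le_of_diagNorm_eq h.symm)
  · intro c
    exact Subalgebra.algebraMap_mem _ c
  · intro f g _ _ hf hg
    exact add_mem hf hg
  · intro f g _ _ hf hg
    exact mul_mem hf hg

lemma point_le_of_diagNorm_eq [FiniteDimensional k V] {n : ℕ}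
    {e e' : Module.Basis (Fin n) k (Module.Dual k V)} {a : Trop (diagTorus e).1}
    {b : Trop (diagTorus e').1}
    (h : diagNorm e (diagCoord e a) = diagNorm e' (diagCoord e' b)) (f : CoordRing k V) :
    (point (diagTorus e') b).1 f ≤ (point (diagTorus e) a).1 f :=
  point_le_point fun _ ⟨x, hx⟩ => exists_weight_le (mem_dominatedSpan h x f) hx

/-! ### Norms over a trivially valued field are diagonalizable -/

section NANorm

variable {W : Type v} [AddCommGroup W] [Module k W] (N : NANorm k W)

lemma NANorm.map_zero : N.toFun 0 = 0 := (N.eq_zero_iff' 0).2 rfl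

lemma NANorm.map_smul_of_ne_zero {c : k} (hc : c ≠ 0) (w : W) : N.toFun (c • w) = N.toFun w := by
  rw [N.smul', trivAbs_of_ne hc, one_mul]

lemma NANorm.map_smul_le (c : k) (w : W) : N.toFun (c • w) ≤ N.toFun w := by
  by_cases hc : c = 0
  · rw [hc, zero_smul, N.map_zero]
    exact N.nonneg' w
  · exact (N.map_smul_of_ne_zero hc w).le

lemma NANorm.map_sub_le (w w' : W) : N.toFun (w - w') ≤ max (N.toFun w) (N.toFun w') := by
  have := N.add_le' w ((-1 : k) • w')
  rwa [N.map_smul_of_ne_zero (neg_ne_zero.2 one_ne_zero), neg_one_smul, ← sub_eq_add_neg] at this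

/-- A ball of a norm over a trivially valued field is a linear subspace. -/
def NANorm.ball {r : ℝ} (hr : 0 ≤ r) : Submodule k W where
  carrier := {w | N.toFun w ≤ r}
  add_mem' hx hy := (N.add_le' _ _).trans (max_le hx hy)
  zero_mem' := N.map_zero.trans_le hr
  smul_mem' c w hw := (N.map_smul_le c w).trans hw

/-- The descending chain condition for balls makes a norm attain its minimum on every nonempty
set. -/
lemma NANorm.exists_min [FiniteDimensional k W] {S : Set W} (hS : S.Nonempty) :
    ∃ w ∈ S, ∀ w' ∈ S, N.toFun w ≤ N.toFun w' := by
  obtain ⟨_, ⟨w, hw, rfl⟩, hmin⟩ := IsArtinian.set_has_minimal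
    ((fun w => N.ball (N.nonneg' w)) '' S) (hS.image _)
  refine ⟨w, hw, fun w' hw' => ?_⟩
  by_contra! hlt
  refine hmin _ ⟨w', hw', rfl⟩ (lt_of_le_of_ne (fun z hz => le_trans hz hlt.le) fun heq => ?_)
  have h1 : w ∈ N.ball (N.nonneg' w) := le_refl (N.toFun w)
  have heq' : N.ball (N.nonneg' w') = N.ball (N.nonneg' w) := heq
  rw [← heq'] at h1
  exact absurd h1 (not_le.2 hlt)

/-- There are linearly independent orthogonal families of every length up to the dimension: a
vector outside the span that minimizes the norm on its coset is orthogonal to the span. -/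
lemma NANorm.exists_orthogonal [FiniteDimensional k W] (d : ℕ) (hd : d ≤ Module.finrank k W) :
    ∃ w : Fin d → W, LinearIndependent k w ∧
      ∀ (c : Fin d → k) (i : Fin d), c i ≠ 0 → N.toFun (w i) ≤ N.toFun (∑ j, c j • w j) := by
  induction d with
  | zero => exact ⟨Fin.elim0, linearIndependent_empty_type, fun _ i => i.elim0⟩
  | succ d ih =>
    obtain ⟨w, hw, ho⟩ := ih (Nat.le_of_succ_le hd)
    obtain ⟨z, hz⟩ : ∃ z, z ∉ Submodule.span k (Set.range w) := by
      by_contra! hall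
      have h1 := finrank_span_eq_card hw
      rw [(Submodule.eq_top_iff'.2 hall), finrank_top, Fintype.card_fin] at h1
      omega
    obtain ⟨_, ⟨u, hu, rfl⟩, hmin⟩ := N.exists_min
      (S := (fun u => z + u) '' (Submodule.span k (Set.range w) : Set W))
      ⟨_, 0, zero_mem _, rfl⟩
    have hzu : z + u ∉ Submodule.span k (Set.range w) := fun h =>
      hz ((Submodule.add_mem_iff_left _ hu).1 h)
    have hle : ∀ (c : k) (y : W), c ≠ 0 → y ∈ Submodule.span k (Set.range w) →
        N.toFun (z + u) ≤ N.toFun (c • (z + u) + y) := by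
      intro c y hc hy
      have h1 := hmin _ ⟨u + c⁻¹ • y, add_mem hu (Submodule.smul_mem _ _ hy), rfl⟩
      rw [← N.map_smul_of_ne_zero hc (z + (u + c⁻¹ • y)), ← add_assoc, smul_add,
        smul_inv_smul₀ hc] at h1
      exact h1
    refine ⟨Fin.cons (z + u) w, linearIndependent_finCons.2 ⟨hw, hzu⟩, fun c i hi => ?_⟩
    rw [Fin.sum_univ_succ]
    simp only [Fin.cons_zero, Fin.cons_succ]
    have hy : ∑ j : Fin d, c j.succ • w j ∈ Submodule.span k (Set.range w) :=
      sum_mem fun j _ => Submodule.smul_mem _ _ (Submodule.subset_span ⟨j, rfl⟩)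
    refine Fin.cases (fun h0 => ?_) (fun i hi => ?_) i hi
    · exact hle _ _ h0 hy
    · refine (ho (fun j => c j.succ) i hi).trans ?_
      by_cases h0 : c 0 = 0
      · rw [h0, zero_smul, zero_add]
      · -- the `z`-part is no larger than the whole vector, hence neither is the other part
        have h1 := N.map_sub_le (c 0 • (z + u) + ∑ j : Fin d, c j.succ • w j) (c 0 • (z + u))
        rw [add_sub_cancel_left, N.map_smul_of_ne_zero h0, max_eq_left (hle _ _ h0 hy)] at h1
        exact h1

end NANorm

/-- Every point of the Goldman–Iwahori space lies in the apartment of a basis. -/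
lemma exists_eq_diagNorm [FiniteDimensional k V] {n : ℕ} (hn : Module.finrank k V = n)
    (N : NANorm k (Module.Dual k V)) :
    ∃ (e : Module.Basis (Fin n) k (Module.Dual k V)) (x : Fin n → ℝ), N = diagNorm e x := by
  have hn' : Module.finrank k (Module.Dual k V) = n := by rw [Subspace.dual_finrank_eq, hn]
  obtain ⟨w, hw, ho⟩ := NANorm.exists_orthogonal N n hn'.ge
  let e := basisOfLinearIndependentOfCardEqFinrank' w hw (by rw [hn', Fintype.card_fin])
  have he : ∀ i, e i = w i := fun i => by simp [e]
  have hpos : ∀ i, 0 < N.toFun (e i) := fun i =>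
    lt_of_le_of_ne (N.nonneg' _) fun h => e.ne_zero i ((N.eq_zero_iff' _).1 h.symm)
  refine ⟨e, fun i => -Real.log (N.toFun (e i)), NANorm.ext (funext fun l => ?_)⟩
  change _ = ⨆ i, trivAbs (e.repr l i) * Real.exp (-(-Real.log (N.toFun (e i))))
  have hterm : ∀ i, trivAbs (e.repr l i) * Real.exp (-(-Real.log (N.toFun (e i)))) =
      N.toFun (e.repr l i • e i) := fun i => by
    rw [neg_neg, Real.exp_log (hpos i), ← N.smul']
  simp only [hterm]
  have hnn : 0 ≤ ⨆ i, N.toFun (e.repr l i • e i) := Real.iSup_nonneg fun i => N.nonneg' _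
  apply le_antisymm
  · have hsum : ∀ s : Finset (Fin n),
        N.toFun (∑ i ∈ s, e.repr l i • e i) ≤ ⨆ i, N.toFun (e.repr l i • e i) := by
      classical
      intro s
      induction s using Finset.induction_on with
      | empty => rw [Finset.sum_empty, NANorm.map_zero]; exact hnn
      | insert i s hi ih =>
        rw [Finset.sum_insert hi]
        exact (N.add_le' _ _).trans
          (max_le (le_ciSup (f := fun i => N.toFun (e.repr l i • e i))
            (Set.finite_range _).bddAbove i) ih)
    have := hsum Finset.univ
    rwa [e.sum_repr] at this
  · refine Real.iSup_le (fun i => ?_) (N.nonneg' l)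
    by_cases hi : e.repr l i = 0
    · rw [hi, zero_smul, NANorm.map_zero]
      exact N.nonneg' l
    · rw [NANorm.map_smul_of_ne_zero N hi, he]
      have := ho (e.repr l) i hi
      simp only [← he, e.sum_repr] at this
      rwa [he] at this

/-! ### Coordinates on an apartment -/

lemma exists_diagChar_eq [FiniteDimensional k V] {n : ℕ}
    (e : Module.Basis (Fin n) k (Module.Dual k V)) (s : Fin n → kˣ) :
    ∃ t : (diagTorus e).1, ∀ i, (diagCharacter e i).1 t = s i := by
  obtain ⟨t, ht⟩ := (diag_bijective e).2 s
  exact ⟨t, fun i => congrFun ht i⟩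

lemma eq_zero_of_two_zpow_eq_one [CharZero k] {z : ℤ}
    (hz : (Units.mk0 (2 : k) two_ne_zero) ^ z = 1) : z = 0 := by
  have h1 : (((2 : ℚ) ^ z : ℚ) : k) = ((1 : ℚ) : k) := by
    have := congrArg Units.val hz
    simpa using this
  exact (zpow_eq_one_iff_right₀ (by norm_num) (by norm_num)).1 (Rat.cast_injective h1)

/-- The characters `ε_i` are independent, and `ℝ` is divisible, so the coordinates of a point of
`T^trop` can be prescribed. -/
lemma exists_diagCoord_eq [CharZero k] [FiniteDimensional k V] {n : ℕ}
    (e : Module.Basis (Fin n) k (Module.Dual k V)) (x : Fin n → ℝ) :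
    ∃ a : Trop (diagTorus e).1, diagCoord e a = x := by
  let ψ : (Fin n → ℤ) →+ Additive (Characters (diagTorus e).1) :=
    { toFun := fun z => ∑ i, z i • Additive.ofMul (diagCharacter e i)
      map_zero' := by simp
      map_add' := fun z z' => by simp [add_smul, Finset.sum_add_distrib] }
  have hψ : Function.Injective ψ := by
    rw [injective_iff_map_eq_zero]
    intro z hz
    funext i
    -- evaluate at the element of the torus with `ε_i = 2` and all other coordinates `1`
    obtain ⟨t, ht⟩ := exists_diagChar_eq e (Pi.mulSingle i (Units.mk0 (2 : k) two_ne_zero))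
    have h1 : (∏ j, (diagCharacter e j) ^ z j : Characters (diagTorus e).1).1 t = 1 := by
      have h2 : (∏ j, (diagCharacter e j) ^ z j : Characters (diagTorus e).1) = 1 := hz
      rw [h2]
      rfl
    refine eq_zero_of_two_zpow_eq_one (k := k) ?_
    rw [← h1, Subgroup.val_finsetProd, MonoidHom.finsetProd_apply, Finset.prod_eq_single i]
    · rw [Subgroup.coe_zpow, MonoidHom.zpow_apply, ht, Pi.mulSingle_eq_same]
    · intro j _ hj
      rw [Subgroup.coe_zpow, MonoidHom.zpow_apply, ht, Pi.mulSingle_eq_of_ne hj, one_zpow]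
    · simp
  let g : (Fin n → ℤ) →+ ℝ :=
    { toFun := fun z => ∑ i, z i * x i
      map_zero' := by simp
      map_add' := fun z z' => by simp [add_mul, Finset.sum_add_distrib] }
  obtain ⟨a, ha⟩ := (Module.Baer.of_divisible ℝ).extension_property_addMonoidHom ψ hψ g
  refine ⟨a, funext fun i => ?_⟩
  have h1 := DFunLike.congr_fun ha (Pi.single i 1)
  have h2 : ψ (Pi.single i 1) = Additive.ofMul (diagCharacter e i) := by
    change ∑ j, (Pi.single i 1 : Fin n → ℤ) j • Additive.ofMul (diagCharacter e j) = _
    rw [Finset.sum_eq_single i] <;> simp +contextual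
  have h3 : g (Pi.single i 1) = x i := by
    change ∑ j, ((Pi.single i 1 : Fin n → ℤ) j : ℝ) * x j = _
    rw [Finset.sum_eq_single i] <;> simp +contextual
  rw [AddMonoidHom.comp_apply, h2, h3] at h1
  exact h1

/-! ### The comparison map -/

/-- The norm of a point does not depend on the apartment in which the point is presented. -/
lemma diagNorm_eq_of_point_eq [FiniteDimensional k V] {n : ℕ}
    {e e' : Module.Basis (Fin n) k (Module.Dual k V)} {a : Trop (diagTorus e).1}
    {b : Trop (diagTorus e').1} (h : point (diagTorus e) a = point (diagTorus e') b) :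
    diagNorm e (diagCoord e a) = diagNorm e' (diagCoord e' b) := by
  refine NANorm.ext (funext fun l => ?_)
  rcases subsingleton_or_nontrivial V with hV | hV
  · rw [Subsingleton.elim l 0]
    exact (NANorm.map_zero _).trans (NANorm.map_zero _).symm
  · obtain ⟨v, hv⟩ := exists_ne (0 : V)
    rw [← point_matrixCoeff e a l hv, h, point_matrixCoeff e' b l hv]

end GLBuild

end

theorem mainTheorem6 {k : Type*} [Field k] [IsAlgClosed k] [CharZero k]
    {V : Type*} [AddCommGroup V] [Module k V] [FiniteDimensional k V]
    (n : ℕ) (hn : Module.finrank k V = n) :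
    (∃! α : GLBuild.BerkBuilding k V → GLBuild.GoldmanIwahori k V,
      ∀ (e : Module.Basis (Fin n) k (Module.Dual k V)) (a : GLBuild.Trop (GLBuild.diagTorus e).1),
        α (GLBuild.point (GLBuild.diagTorus e) a) =
          GLBuild.diagNorm e (GLBuild.diagCoord e a)) ∧
    ∀ α : GLBuild.BerkBuilding k V → GLBuild.GoldmanIwahori k V,
      (∀ (e : Module.Basis (Fin n) k (Module.Dual k V))
          (a : GLBuild.Trop (GLBuild.diagTorus e).1),
        α (GLBuild.point (GLBuild.diagTorus e) a) =
          GLBuild.diagNorm e (GLBuild.diagCoord e a)) →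
      Continuous α ∧ Function.Bijective α := by
  constructor
  · choose e a hp using GLBuild.exists_eq_point (k := k) (V := V) hn
    refine ⟨fun p => GLBuild.diagNorm (e p) (GLBuild.diagCoord (e p) (a p)), fun e' b => ?_,
      fun β hβ => funext fun p => ?_⟩
    · exact GLBuild.diagNorm_eq_of_point_eq (hp _).symm
    · rw [← hβ (e p) (a p), ← hp]
  · intro α hα
    refine ⟨?_, ?_, fun N => ?_⟩
    · refine continuous_iInf_rng.2 fun l => continuous_induced_rng.2 ?_
      change Continuous fun p => (α p).toFun l
      rcases subsingleton_or_nontrivial V with hV | hV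
      · have h0 : ∀ p, (α p).toFun l = 0 := fun p => by
          rw [Subsingleton.elim l 0]
          exact GLBuild.NANorm.map_zero (α p)
        simp only [h0]
        exact continuous_const
      · obtain ⟨v, hv⟩ := exists_ne (0 : V)
        have h0 : ∀ p, (α p).toFun l = p.1 (GLBuild.matrixCoeff l v) := fun p => by
          obtain ⟨e, a, rfl⟩ := GLBuild.exists_eq_point hn p
          rw [hα, GLBuild.point_matrixCoeff e a l hv]
        simp only [h0]
        exact (continuous_apply _).comp continuous_subtype_val
    · intro p q hpq
      obtain ⟨e, a, rfl⟩ := GLBuild.exists_eq_point hn p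
      obtain ⟨e', b, rfl⟩ := GLBuild.exists_eq_point hn q
      rw [hα, hα] at hpq
      exact Subtype.ext (funext fun f => le_antisymm
        (GLBuild.point_le_of_diagNorm_eq hpq.symm f) (GLBuild.point_le_of_diagNorm_eq hpq f))
    · obtain ⟨e, x, rfl⟩ := GLBuild.exists_eq_diagNorm hn N
      obtain ⟨a, rfl⟩ := GLBuild.exists_diagCoord_eq e x
      exact ⟨GLBuild.point (GLBuild.diagTorus e) a, hα e a⟩
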